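/- Let $k$ be an algebraically closed field of characteristic $0$ (for example $\mathbf{C}$), let $X$ be a smooth projective irreducible curve over $k$, and let $t$ be a rational function on $X$ with the ramification of the degree-$28$ Belyi function on the Shimura curve $\mathcal{X}_0(3)$ of the $(2,3,7)$ triangle group: $t$ is unramified outside $t=0,1,\infty$, and $$t^*(0)=2D_{14},\qquad t^*(1)=3D_9+(P_0),\qquad t^*(\infty)=7D_4,$$ where $D_{14},D_9,D_4$ are sums of $14$, $9$, $4$ distinct points respectively and $P_0$ is a point not occurring in $D_9$. Let $F_{14},F_9,F_4$ be nonzero rational functions on $X$ with divisors $D_{14}-14(P_0)$, $D_9-9(P_0)$, $D_4-4(P_0)$ respectively. Let $\omega$ be a nonzero holomorphic differential on $X$. Then there is a derivation $f\mapsto f'$ of the function field of $X$ over $k$ with $df=f'\omega$ for all $f$ (necessarily unique), and it satisfies the following. (i) $F_{14}$, $F_9^2$, $F_4^6$ are nonzero scalar multiples (by elements of $k^*$) of $$3F_4F_9'-7F_4'F_9,\qquad 2F_4F_{14}'-7F_4'F_{14},\qquad 2F_9F_{14}'-3F_9'F_{14}$$ respectively. (ii) Each of the functions $$\frac{14F_9F_4''-13F_9'F_4'}{F_4},\qquad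 \frac{6F_4F_9''-29F_4'F_9'}{F_9},\qquad \frac{6F_4F_{14}''-43F_4'F_{14}'}{F_{14}}$$ on $X$ is regular at every point other than $P_0$, and is not regular at $P_0$. -/

import Mathlib

open scoped WithZero KaehlerDifferential

/-- `F` is a function field in one variable over `k`, i.e. the field of rational functions of an
integral curve over `k`: it is finite over `k(x)` for some `x` transcendental over `k`. -/
def IsFunctionFieldOfCurve (k F : Type*) [Field k] [Field F] [Algebra k F] : Prop :=
  ∃ x : F, Transcendental k x ∧ FiniteDimensional (IntermediateField.adjoin k {x}) F

/-- The closed points of the smooth projective curve over `k` with function field `F`: the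
normalized (that is, surjective) discrete valuations of `F` that are trivial on `k`. The valuation
is written multiplicatively, `v f = exp (-ord f)`. -/
@[ext]
structure CurvePoint (k F : Type*) [Field k] [Field F] [Algebra k F] where
  /-- the valuation attached to the point -/
  v : Valuation F ℤᵐ⁰
  surjective : Function.Surjective v
  trivial_on_base : ∀ c : k, c ≠ 0 → v (algebraMap k F c) = 1

/-- Divisors on the curve with function field `F`. -/
abbrev CurveDivisor (k F : Type*) [Field k] [Field F] [Algebra k F] : Type _ :=
  CurvePoint k F →₀ ℤ

section Curve

variable {k F : Type*} [Field k] [Field F] [Algebra k F]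

namespace CurvePoint

/-- The order of vanishing of a nonzero rational function `f` at `P`
(negative at poles; the value at `f = 0` is the junk value `0`). -/
noncomputable def ord (P : CurvePoint k F) (f : F) : ℤ := -WithZero.log (P.v f)

/-- The rational function `f` is regular at `P`. -/
def IsRegularAt (P : CurvePoint k F) (f : F) : Prop := P.v f ≤ 1

/-- `u` is a local parameter at `P`, i.e. it has a simple zero there. -/
def IsUniformizer (P : CurvePoint k F) (u : F) : Prop := P.v u = WithZero.exp (-1 : ℤ)

/-- The rational differential `ω` is regular (holomorphic) at `P`: it is `g du` with `u` a local
parameter at `P` and `g` regular at `P`. -/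
def IsRegularDifferentialAt (P : CurvePoint k F) (ω : Ω[F⁄k]) : Prop :=
  ∃ u g : F, P.IsUniformizer u ∧ P.IsRegularAt g ∧ ω = g • KaehlerDifferential.D k F u

end CurvePoint

/-- A rational differential is holomorphic if it is regular at every point of the curve. -/
def IsHolomorphicDifferential (ω : Ω[F⁄k]) : Prop :=
  ∀ P : CurvePoint k F, P.IsRegularDifferentialAt ω

/-- The reduced effective divisor which is the sum of the distinct points in `S`. -/
noncomputable def sumOfPoints (S : Finset (CurvePoint k F)) : CurveDivisor k F :=
  ∑ P ∈ S, Finsupp.single P 1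

/-- The rational function `f` is nonzero and has divisor `D`. -/
def HasDivisor (f : F) (D : CurveDivisor k F) : Prop :=
  f ≠ 0 ∧ ∀ P : CurvePoint k F, P.ord f = D P

/-- The multiplicity of `P` in the divisor `t^*(c)`, the fibre of the nonconstant rational function
`t` over `c : k`, i.e. the order of the zero of `t - c` at `P`. -/
noncomputable def fiberMultiplicity (t : F) (c : k) (P : CurvePoint k F) : ℤ :=
  max (P.ord (t - algebraMap k F c)) 0

/-- The multiplicity of `P` in the divisor `t^*(∞)`, i.e. the order of the pole of `t` at `P`. -/
noncomputable def poleMultiplicity (t : F) (P : CurvePoint k F) : ℤ :=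
  max (-P.ord t) 0

/-- `t` is a Belyi function with the ramification of the degree-28 function on the Shimura curve
`X₀(3)` of the (2,3,7) triangle group: it is unramified outside `t = 0, 1, ∞`, and
`t^*(0) = 2 D₁₄`, `t^*(1) = 3 D₉ + (P₀)`, `t^*(∞) = 7 D₄`, where `D₁₄, D₉, D₄` are sums
of `14, 9, 4` distinct points and `P₀` is a point that does not occur in `D₉`. -/
structure IsBelyiFunction237 (t : F) (P₀ : CurvePoint k F)
    (S₁₄ S₉ S₄ : Finset (CurvePoint k F)) : Prop where
  card_fourteen : S₁₄.card = 14
  card_nine : S₉.card = 9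
  card_four : S₄.card = 4
  base_notMem : P₀ ∉ S₉
  fiber_zero : ∀ P, fiberMultiplicity t (0 : k) P = (2 • sumOfPoints S₁₄ : CurveDivisor k F) P
  fiber_one : ∀ P, fiberMultiplicity t (1 : k) P =
    (3 • sumOfPoints S₉ + Finsupp.single P₀ 1 : CurveDivisor k F) P
  fiber_infty : ∀ P, poleMultiplicity t P = (7 • sumOfPoints S₄ : CurveDivisor k F) P
  unramified : ∀ c : k, c ≠ 0 → c ≠ 1 → ∀ P, fiberMultiplicity t c P ≤ 1

end Curve

/-! Comparing divisors gives `t = a F₁₄²/F₄⁷` and `t - 1 = b F₉³/F₄⁷` with constants `a`, `b`. At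
each point some `t - c` has a nonzero order `n`, so `dt/du` has order `n - 1` for a local parameter
`u`; this is the order of `G = F₁₄ F₉²/F₄⁸`. Writing `ω = g du` with `g` regular, `G/t'` has the
order of `g` and hence no poles. It is therefore constant: `t'` is a multiple of `G` and `ω` has no
zeros (`IsBelyiFunction237.derivation_eq`). This replaces any appeal to Riemann-Hurwitz.

Computing `t'` from both expressions gives two relations of (i), and `a F₁₄² - b F₉³ = F₄⁷` gives
the third (`wronskian_relations`). Differentiating them yields identities `B * A = C * R`, where `A
/ C` is a function of (ii), `R` is regular off `P₀`, and `B`, `C` have no common zero off `P₀`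
(`second_order_relations`). At `P₀` a nonzero leading coefficient shows that the pole is really
there (`v_second_order_eq`).

The foundations are that functions without poles are constant, and that a derivation regular on a
local parameter preserves the local ring (`v_derivation_le_one`). -/

namespace IsFunctionFieldOfCurve

/-! ### Finiteness over k(u), integral closures of k[u], and differentials -/

open scoped IntermediateField.algebraAdjoinAdjoin

variable {k F : Type*} [Field k] [Field F] [Algebra k F]

/-- A function field in one variable is finite over `k(u)` for every transcendental `u`. -/
theorem finiteDimensional_adjoin (hF : IsFunctionFieldOfCurve k F) {u : F}
    (hu : Transcendental k u) : FiniteDimensional (IntermediateField.adjoin k {u}) F := by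
  obtain ⟨x, -, hfin⟩ := hF
  have halgx : Algebra.IsAlgebraic (Algebra.adjoin k {x}) F :=
    (IsFractionRing.comap_isAlgebraic_iff (K := IntermediateField.adjoin k {x})).mpr inferInstance
  have htr : Algebra.trdeg k F ≤ 1 := by
    simpa using Algebra.IsAlgebraic.trdeg_le_cardinalMk k ({x} : Set F)
  have hb : IsTranscendenceBasis k (fun _ : Unit ↦ u) :=
    ((algebraicIndependent_unique_type_iff).mpr hu).isTranscendenceBasis_of_lift_trdeg_le_of_finite
      (by simpa using htr)
  have halgu : Algebra.IsAlgebraic (Algebra.adjoin k {u}) F := by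
    have := hb.isAlgebraic
    rwa [Set.range_const] at this
  have : Algebra.IsAlgebraic (IntermediateField.adjoin k {u}) F :=
    (IsFractionRing.comap_isAlgebraic_iff (A := Algebra.adjoin k {u})).mp halgu
  have : Algebra.EssFiniteType k (IntermediateField.adjoin k {x}) :=
    IntermediateField.essFiniteType_iff.mpr (IntermediateField.fg_adjoin_of_finite (Set.finite_singleton x))
  have : Algebra.EssFiniteType k F := .comp k (IntermediateField.adjoin k {x}) F
  have : Algebra.EssFiniteType (IntermediateField.adjoin k {u}) F := .of_comp k _ F
  exact Algebra.finite_of_essFiniteType_of_isAlgebraic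

theorem isPrincipalIdealRing_adjoin (u : F) : IsPrincipalIdealRing (Algebra.adjoin k {u}) := by
  have h := (Algebra.adjoin_singleton_eq_range_aeval k u)
  rw [h]
  exact IsPrincipalIdealRing.of_surjective (Polynomial.aeval u : Polynomial k →ₐ[k] F).rangeRestrict
    (AlgHom.rangeRestrict_surjective _)

theorem isFractionRing_integralClosure (hF : IsFunctionFieldOfCurve k F) {u : F}
    (hu : Transcendental k u) : IsFractionRing (integralClosure (Algebra.adjoin k {u}) F) F := by
  have := hF.finiteDimensional_adjoin hu
  exact IsIntegralClosure.isFractionRing_of_finite_extension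
    (Algebra.adjoin k {u}) (IntermediateField.adjoin k {u}) _ _

variable [CharZero k]

theorem isDedekindDomain_integralClosure (hF : IsFunctionFieldOfCurve k F) {u : F}
    (hu : Transcendental k u) : IsDedekindDomain (integralClosure (Algebra.adjoin k {u}) F) := by
  have := hF.finiteDimensional_adjoin hu
  have := isPrincipalIdealRing_adjoin (k := k) u
  exact integralClosure.isDedekindDomain (Algebra.adjoin k {u}) (IntermediateField.adjoin k {u}) F 

theorem finite_integralClosure (hF : IsFunctionFieldOfCurve k F) {u : F}
    (hu : Transcendental k u) :
    Module.Finite (Algebra.adjoin k {u}) (integralClosure (Algebra.adjoin k {u}) F) := by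
  have := hF.finiteDimensional_adjoin hu
  have := isPrincipalIdealRing_adjoin (k := k) u
  exact IsIntegralClosure.finite (Algebra.adjoin k {u}) (IntermediateField.adjoin k {u}) F _

/-- The differential of a transcendental function generates the module of differentials. -/
theorem span_D_eq_top (hF : IsFunctionFieldOfCurve k F) {u : F}
    (hu : Transcendental k u) : Submodule.span F {KaehlerDifferential.D k F u} = ⊤ := by
  set K := IntermediateField.adjoin k {u} with hK
  have := hF.finiteDimensional_adjoin hu
  have : Algebra.FormallyUnramified K F := .of_isSeparable _ _
  set N := Submodule.span F {KaehlerDifferential.D k F u}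
  have hpoly : ∀ a ∈ Algebra.adjoin k {u}, KaehlerDifferential.D k F a ∈ N := by
    intro a ha
    obtain ⟨p, rfl⟩ := (Algebra.adjoin_singleton_eq_range_aeval k u ▸ ha :)
    simpa [Derivation.map_aeval] using N.smul_mem _ (Submodule.mem_span_singleton_self _)
  have hbase : ∀ a ∈ K, KaehlerDifferential.D k F a ∈ N := by
    intro a ha
    obtain ⟨r, hr, s, hs, rfl⟩ := IntermediateField.mem_adjoin_iff_div.mp ha
    rw [Derivation.leibniz_div]
    exact N.smul_mem _ (N.sub_mem (N.smul_mem _ (hpoly r hr)) (N.smul_mem _ (hpoly s hs)))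
  -- Modulo `N` the universal derivation kills `k(u)`, so it is `k(u)`-linear; it vanishes because
  -- `F / k(u)` is finite separable.
  let d : Derivation k F (Ω[F⁄k] ⧸ N) := N.mkQ.compDer (KaehlerDifferential.D k F)
  have hd : ∀ a ∈ K, d a = 0 := fun a ha ↦ (Submodule.Quotient.mk_eq_zero N).mpr (hbase a ha)
  let e : Derivation K F (Ω[F⁄k] ⧸ N) :=
    Derivation.mk'
      { toFun := d
        map_add' := d.map_add
        map_smul' := fun c f ↦ by
          rw [Algebra.smul_def, Derivation.leibniz]
          rw [show d (algebraMap K F c) = 0 from hd _ c.2, smul_zero, add_zero]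
          rfl }
      d.leibniz
  have he : e = 0 := by
    rw [← e.liftKaehlerDifferential_comp, Subsingleton.elim e.liftKaehlerDifferential 0]
    ext; simp
  rw [eq_top_iff, ← KaehlerDifferential.span_range_derivation, Submodule.span_le]
  rintro _ ⟨f, rfl⟩
  exact (Submodule.Quotient.mk_eq_zero N).mp (congrArg (fun D ↦ D f) he : _)

end IsFunctionFieldOfCurve

/-! ### Values of functions at points, and existence of poles -/

namespace CurvePoint

open scoped IntermediateField.algebraAdjoinAdjoin

variable {k F : Type*} [Field k] [Field F] [Algebra k F] (P : CurvePoint k F)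

theorem v_algebraMap_le_one (c : k) : P.v (algebraMap k F c) ≤ 1 := by
  rcases eq_or_ne c 0 with rfl | hc
  · simp
  · exact (P.trivial_on_base c hc).le

theorem v_le_one_of_mem_adjoin {u f : F} (hu : P.v u ≤ 1) (hf : f ∈ Algebra.adjoin k {u}) :
    P.v f ≤ 1 := by
  induction hf using Algebra.adjoin_induction with
  | mem x hx => rwa [Set.mem_singleton_iff.mp hx]
  | algebraMap c => exact P.v_algebraMap_le_one c
  | add x y _ _ hx hy => exact P.v.map_add_le hx hy
  | mul x y _ _ hx hy => rw [map_mul]; exact mul_le_one' hx hy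

theorem v_le_one_of_isIntegral {A : Subalgebra k F} (hA : ∀ a ∈ A, P.v a ≤ 1) {f : F}
    (hf : IsIntegral A f) : P.v f ≤ 1 :=
  (Valuation.integer.integers P.v).mem_of_integral
    (hf.map_of_comp_eq (Subring.inclusion (S := A.toSubring) (T := P.v.integer) hA)
      (RingHom.id F) rfl)

variable {P} in
theorem IsUniformizer.ne_zero {u : F} (hu : P.IsUniformizer u) : u ≠ 0 := by
  rintro rfl
  rw [IsUniformizer, map_zero] at hu
  exact WithZero.exp_ne_zero hu.symm

variable {P} in
theorem IsUniformizer.v_lt_one {u : F} (hu : P.IsUniformizer u) : P.v u < 1 := by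
  rw [hu, ← WithZero.exp_zero, WithZero.exp_lt_exp]; norm_num

variable {P} in
theorem IsUniformizer.v_le_of_lt_one {u f : F} (hu : P.IsUniformizer u) (hf : P.v f < 1) :
    P.v f ≤ P.v u := by
  rcases eq_or_ne f 0 with rfl | h
  · simp
  rw [hu]
  have h0 : P.v f ≠ 0 := P.v.ne_zero_iff.mpr h
  rw [← WithZero.exp_zero, ← WithZero.log_lt_iff_lt_exp h0] at hf
  rw [← WithZero.log_le_iff_le_exp h0]
  omega

theorem v_intCast [CharZero k] {n : ℤ} (hn : n ≠ 0) : P.v (n : F) = 1 := by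
  have := P.trivial_on_base (n : k) (by exact_mod_cast hn)
  rwa [map_intCast] at this

section IsAlgClosed

variable [IsAlgClosed k]

omit P in
theorem _root_.exists_algebraMap_eq_of_not_transcendental {f : F} (hf : ¬ Transcendental k f) :
    ∃ c : k, algebraMap k F c = f := by
  have hint : IsIntegral k f := (not_not.mp hf : IsAlgebraic k f).isIntegral
  exact minpoly.mem_range_of_degree_eq_one k f
    (IsAlgClosed.degree_eq_one_of_irreducible k (minpoly.irreducible hint))

theorem transcendental_of_v_ne_one {f : F} (h0 : f ≠ 0) (h1 : P.v f ≠ 1) :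
    Transcendental k f := by
  by_contra h
  obtain ⟨c, rfl⟩ := exists_algebraMap_eq_of_not_transcendental h
  exact h1 (P.trivial_on_base c fun hc ↦ h0 (by simp [hc]))

variable {P} in
theorem IsUniformizer.transcendental {u : F} (hu : P.IsUniformizer u) : Transcendental k u :=
  P.transcendental_of_v_ne_one hu.ne_zero hu.v_lt_one.ne

/-- Every function that is regular at `P` has a value at `P`. -/
theorem exists_v_sub_algebraMap_lt_one (hF : IsFunctionFieldOfCurve k F) {f : F}
    (hf : P.v f ≤ 1) : ∃ c : k, P.v (f - algebraMap k F c) < 1 := by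
  by_contra! H
  have htr : Transcendental k f := by
    by_contra h
    obtain ⟨c, rfl⟩ := exists_algebraMap_eq_of_not_transcendental h
    simpa using H c
  have := hF.finiteDimensional_adjoin htr
  have H1 : ∀ c, P.v (f - algebraMap k F c) = 1 := fun c ↦
    le_antisymm (P.v.map_sub_le hf (P.v_algebraMap_le_one c)) (H c)
  -- If `f` has no value at `P`, every factor `f - c` is a unit there, so the valuation is trivial
  -- on `k(f)`. As `F` is integral over `k(f)`, no function has a pole at `P`, against surjectivity.
  have hpoly : ∀ p : Polynomial k, p ≠ 0 → P.v (Polynomial.aeval f p) = 1 := by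
    intro p hp
    rw [(IsAlgClosed.splits p).eq_prod_roots]
    simp only [map_mul, Polynomial.aeval_C, map_multiset_prod, Multiset.map_map]
    rw [P.trivial_on_base _ (Polynomial.leadingCoeff_ne_zero.mpr hp), one_mul]
    apply Multiset.prod_eq_one
    simp only [Multiset.mem_map]
    rintro _ ⟨c, -, rfl⟩
    simpa using H1 c
  have hK : ∀ a ∈ IntermediateField.adjoin k {f}, P.v a ≤ 1 := by
    intro a ha
    obtain ⟨r, hr, s, hs, rfl⟩ := IntermediateField.mem_adjoin_iff_div.mp ha
    rw [Algebra.adjoin_singleton_eq_range_aeval] at hr hs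
    obtain ⟨p, rfl⟩ := hr
    obtain ⟨q, rfl⟩ := hs
    rcases eq_or_ne p 0 with rfl | hp
    · simp
    rcases eq_or_ne q 0 with rfl | hq
    · simp
    rw [map_div₀]
    change P.v (Polynomial.aeval f p) / P.v (Polynomial.aeval f q) ≤ 1
    simp [hpoly p hp, hpoly q hq]
  obtain ⟨g, hg⟩ := P.surjective (WithZero.exp 1)
  have : P.v g ≤ 1 := P.v_le_one_of_isIntegral
    (A := (IntermediateField.adjoin k {f}).toSubalgebra) hK
    (Algebra.IsIntegral.isIntegral (R := IntermediateField.adjoin k {f}) g)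
  rw [hg, ← WithZero.exp_zero, WithZero.exp_le_exp] at this
  norm_num at this

end IsAlgClosed

variable [CharZero k]

/-- A transcendental function has a pole. -/
theorem _root_.IsFunctionFieldOfCurve.exists_one_lt_v (hF : IsFunctionFieldOfCurve k F) {f : F}
    (hf : Transcendental k f) : ∃ P : CurvePoint k F, 1 < P.v f := by
  -- A pole of `f` is a zero of `u = f⁻¹`, found as a maximal ideal containing `u` in the integral
  -- closure of `k[u]`. Such an ideal exists because `u` is not a unit: by integrality it would
  -- already be one in the polynomial ring `k[u]`.
  have hu : Transcendental k f⁻¹ := by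
    intro h; exact hf (inv_inv f ▸ h.inv)
  set u := f⁻¹ with hu'
  have hf0 : f ≠ 0 := by rintro rfl; exact hf isAlgebraic_zero
  have hu0 : u ≠ 0 := inv_ne_zero hf0
  set A := Algebra.adjoin k {u} with hA
  have := hF.isDedekindDomain_integralClosure hu
  have := hF.isFractionRing_integralClosure hu
  set B := integralClosure A F
  let a : A := ⟨u, Algebra.self_mem_adjoin_singleton k u⟩
  have hunit : ¬ IsUnit (algebraMap A B a) := by
    intro h
    have hinj : Function.Injective (algebraMap A B) := by
      intro x y hxy
      exact Subtype.ext (congrArg (algebraMap B F) hxy)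
    have := (faithfulSMul_iff_algebraMap_injective A B).mpr hinj
    have : Algebra.IsIntegral A B := integralClosure.AlgebraIsIntegral
    have h1 : IsUnit a := isUnit_of_map_unit (algebraMap A B) a h
    obtain ⟨b, hb⟩ := h1.exists_right_inv
    obtain ⟨p, hp : Polynomial.aeval u p = b⟩ :=
      (Algebra.adjoin_singleton_eq_range_aeval k u).le b.2
    have h2 : Polynomial.aeval u (Polynomial.X * p - 1) = 0 := by
      have hb' : u * (b : F) = 1 := congrArg (fun z : A ↦ (z : F)) hb
      simp [hp, hb']
    have h3 := (transcendental_iff.mp hu _ h2)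
    have := congrArg (Polynomial.eval 0) h3
    simp at this
  obtain ⟨M, hM, haM⟩ := exists_max_ideal_of_mem_nonunits hunit
  have hMbot : M ≠ ⊥ := by
    rintro rfl
    apply hu0
    exact congrArg (algebraMap B F) ((Ideal.mem_bot).mp haM)
  let Q : IsDedekindDomain.HeightOneSpectrum B := ⟨M, hM.isPrime, hMbot⟩
  have hle : ∀ c : k, Q.valuation F (algebraMap k F c) ≤ 1 := fun c ↦
    Q.valuation_le_one (K := F) (algebraMap A B (algebraMap k A c))
  refine ⟨⟨Q.valuation F, Q.valuation_surjective F, fun c hc ↦ ?_⟩, ?_⟩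
  · refine le_antisymm (hle c) ?_
    rw [Valuation.one_le_val_iff _ (by simpa using hc), ← map_inv₀]
    exact hle _
  · change 1 < Q.valuation F f
    have h : Q.valuation F u < 1 :=
      (Q.valuation_lt_one_iff_mem (K := F) (algebraMap A B a)).mpr haM
    exact (Valuation.one_lt_val_iff _ hf0).mpr h

/-- A function without poles is constant. -/
theorem _root_.IsFunctionFieldOfCurve.exists_algebraMap_eq [IsAlgClosed k]
    (hF : IsFunctionFieldOfCurve k F) {f : F} (hf : ∀ P : CurvePoint k F, P.v f ≤ 1) :
    ∃ c : k, algebraMap k F c = f := by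
  apply exists_algebraMap_eq_of_not_transcendental
  intro h
  obtain ⟨P, hP⟩ := hF.exists_one_lt_v h
  exact (hf P).not_gt hP

end CurvePoint

/-! ### The effect of a derivation on orders at a point -/

namespace CurvePoint

open scoped IntermediateField.algebraAdjoinAdjoin

variable {k F : Type*} [Field k] [Field F] [Algebra k F] {P : CurvePoint k F}

/-- The integral closure is a finite `k[u]`-module, so Leibniz reduces the bound to finitely many
generators and to `δ u`. The bound is crude; only its uniformity matters. -/
theorem exists_bound_derivation_integralClosure [CharZero k] (hF : IsFunctionFieldOfCurve k F)
    {u : F} (hu : Transcendental k u) (hPu : P.v u ≤ 1) (δ : Derivation k F F) :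
    ∃ C : ℤᵐ⁰, ∀ b ∈ integralClosure (Algebra.adjoin k {u}) F, P.v (δ b) ≤ C := by
  set A := Algebra.adjoin k {u}
  set B := integralClosure A F
  have := hF.finite_integralClosure hu
  obtain ⟨s, hs⟩ := (Module.finite_def.mp this : (⊤ : Submodule A B).FG)
  have hAv : ∀ a ∈ A, P.v a ≤ 1 := fun a ↦ P.v_le_one_of_mem_adjoin hPu
  have hBv : ∀ b ∈ B, P.v b ≤ 1 := fun b hb ↦ P.v_le_one_of_isIntegral hAv hb
  have hAδ : ∀ a ∈ A, P.v (δ a) ≤ P.v (δ u) := by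
    intro a ha
    obtain ⟨p, rfl⟩ := (Algebra.adjoin_singleton_eq_range_aeval k u).le ha
    change P.v (δ (Polynomial.aeval u p)) ≤ _
    rw [Derivation.map_aeval, smul_eq_mul, map_mul]
    exact mul_le_of_le_one_left' (hAv _ (Polynomial.aeval_mem_adjoin_singleton k u))
  refine ⟨max (P.v (δ u)) (s.sup fun b ↦ P.v (δ b)), fun b hb ↦ ?_⟩
  have hmem : (⟨b, hb⟩ : B) ∈ Submodule.span A (s : Set B) := hs ▸ Submodule.mem_top
  suffices ∀ x ∈ Submodule.span A (s : Set B),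
      P.v (δ (x : F)) ≤ max (P.v (δ u)) (s.sup fun b ↦ P.v (δ b)) from this _ hmem
  intro x hx
  induction hx using Submodule.span_induction with
  | mem x hx => exact le_max_of_le_right (Finset.le_sup (f := fun b : B ↦ P.v (δ b)) hx)
  | zero => simp
  | add x y _ _ hx hy =>
    rw [AddMemClass.coe_add, map_add]
    exact P.v.map_add_le hx hy
  | smul a x _ hx =>
    change P.v (δ ((a : F) * (x : F))) ≤ _
    rw [Derivation.leibniz]
    refine P.v.map_add_le ?_ ?_
    · rw [smul_eq_mul, map_mul]
      exact (mul_le_of_le_one_left' (hAv _ a.2)).trans hx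
    · rw [smul_eq_mul, map_mul]
      exact (mul_le_of_le_one_left' (hBv _ x.2)).trans (le_max_of_le_left (hAδ _ a.2))

/-- The regular functions at `P` are fractions, with denominators that are units at `P`, of
functions integral over `k[u]`. -/
theorem exists_mul_mem_integralClosure [CharZero k] (hF : IsFunctionFieldOfCurve k F)
    {u : F} (hu : Transcendental k u) (hPu : P.v u < 1) {f : F} (hf : P.v f ≤ 1) :
    ∃ s ∈ integralClosure (Algebra.adjoin k {u}) F, P.v s = 1 ∧
      s * f ∈ integralClosure (Algebra.adjoin k {u}) F := by
  set A := Algebra.adjoin k {u}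
  have := hF.isDedekindDomain_integralClosure hu
  have := hF.isFractionRing_integralClosure hu
  set B := integralClosure A F
  have hBv : ∀ b : B, P.v b ≤ 1 := fun b ↦
    P.v_le_one_of_isIntegral (fun a ↦ P.v_le_one_of_mem_adjoin hPu.le) b.2
  let M : Ideal B :=
    { carrier := {b | P.v b < 1}
      add_mem' := fun ha hb ↦ P.v.map_add_lt ha hb
      zero_mem' := by simp
      smul_mem' := fun c b hb ↦ by
        change P.v ((c : F) * (b : F)) < 1
        rw [map_mul]
        exact mul_lt_one_of_nonneg_of_lt_one_right (hBv c) zero_le hb }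
  have hmem : ∀ b : B, b ∈ M ↔ P.v b < 1 := fun _ ↦ Iff.rfl
  have hM : M.IsPrime := by
    refine ⟨fun h ↦ ?_, fun {x y} hxy ↦ ?_⟩
    · have := (hmem 1).mp (h ▸ Submodule.mem_top)
      simp at this
    · by_contra! h
      rw [hmem, hmem, not_lt, not_lt] at h
      rw [hmem] at hxy
      change P.v ((x : F) * (y : F)) < 1 at hxy
      rw [map_mul, le_antisymm (hBv x) h.1, le_antisymm (hBv y) h.2, one_mul] at hxy
      exact hxy.false
  have hbot : M ≠ ⊥ := by
    intro h
    have h1 : algebraMap A B ⟨u, Algebra.self_mem_adjoin_singleton k u⟩ ∈ M := hPu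
    rw [h, Ideal.mem_bot] at h1
    have h2 : u = 0 := congrArg (algebraMap B F) h1
    exact hu (h2 ▸ isAlgebraic_zero)
  let Q : IsDedekindDomain.HeightOneSpectrum B := ⟨M, hM, hbot⟩
  have hQ : ∀ d : Q.asIdeal.primeCompl, P.v ((d : B) : F) = 1 := fun d ↦
    le_antisymm (hBv d) (not_lt.mp fun h ↦ d.2 h)
  -- Either `f = n / d` or `f = d / n`, with `d` a unit at `P`. In the second case regularity of `f`
  -- forces `n` to be a unit too.
  obtain ⟨n, d, h | h⟩ := Q.exists_primeCompl_mul_eq_or_mul_eq f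
  · exact ⟨(d : B), (d : B).2, hQ d, by
      rw [mul_comm]; exact (show f * ((d : B) : F) = (n : F) from h) ▸ n.2⟩
  · have h' : f * (n : F) = ((d : B) : F) := h
    refine ⟨n, n.2, le_antisymm (hBv n) ?_, by rw [mul_comm, h']; exact (d : B).2⟩
    have := hQ d
    rw [← h', map_mul] at this
    rw [← this]
    exact mul_le_of_le_one_left' hf

theorem exists_bound_derivation [CharZero k] (hF : IsFunctionFieldOfCurve k F)
    {u : F} (hu : Transcendental k u) (hPu : P.v u < 1) (δ : Derivation k F F) :
    ∃ C : ℤᵐ⁰, ∀ f, P.v f ≤ 1 → P.v (δ f) ≤ C := by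
  obtain ⟨C, hC⟩ := exists_bound_derivation_integralClosure hF hu hPu.le δ
  refine ⟨C, fun f hf ↦ ?_⟩
  obtain ⟨s, hs, hs1, hsf⟩ := exists_mul_mem_integralClosure hF hu hPu hf
  have h : s * δ f = δ (s * f) - f * δ s := by simp [Derivation.leibniz]
  have h2 : P.v (s * δ f) ≤ C := by
    rw [h]
    refine P.v.map_sub_le (hC _ hsf) ?_
    rw [map_mul]
    exact (mul_le_of_le_one_left' hf).trans (hC _ hs)
  rwa [map_mul, hs1, one_mul] at h2

variable [CharZero k] [IsAlgClosed k]

/-- A derivation that is regular on a local parameter at `P` preserves regularity at `P`. -/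
theorem IsUniformizer.v_derivation_le_one (hF : IsFunctionFieldOfCurve k F) {u : F}
    (hu : P.IsUniformizer u) {δ : Derivation k F F} (hδ : P.v (δ u) ≤ 1) {f : F}
    (hf : P.v f ≤ 1) : P.v (δ f) ≤ 1 := by
  obtain ⟨C, hC⟩ := exists_bound_derivation hF hu.transcendental hu.v_lt_one δ
  -- Bootstrapping: with `f = c + u g`, `δ f = u δ g + g δ u`, so each round improves the uniform
  -- bound `C` by a factor `P.v u < 1` until it drops below 1.
  have step : ∀ n : ℕ, ∀ f, P.v f ≤ 1 → P.v (δ f) ≤ max 1 (P.v u ^ n * C) := by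
    intro n
    induction n with
    | zero => intro f hf; simpa using Or.inr (hC f hf)
    | succ n ih =>
      intro f hf
      obtain ⟨c, hc⟩ := P.exists_v_sub_algebraMap_lt_one hF hf
      set g := (f - algebraMap k F c) / u with hg
      have hfg : f = algebraMap k F c + u * g := by
        rw [hg, mul_div_cancel₀ _ hu.ne_zero]; ring
      have hg1 : P.v g ≤ 1 := by
        rw [hg, map_div₀]
        exact div_le_one_of_le₀ (hu.v_le_of_lt_one hc) zero_le
      rw [hfg, map_add, Derivation.map_algebraMap, zero_add, Derivation.leibniz]
      refine P.v.map_add_le ?_ ?_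
      · rw [smul_eq_mul, map_mul]
        refine (mul_le_mul_right (ih g hg1) _).trans ?_
        rcases le_total 1 (P.v u ^ n * C) with h | h
        · rw [max_eq_right h, pow_succ', mul_assoc]
          exact le_max_right _ _
        · rw [max_eq_left h, mul_one]
          exact hu.v_lt_one.le.trans (le_max_left _ _)
      · rw [smul_eq_mul, map_mul]
        exact (mul_le_one' hg1 hδ).trans (le_max_left _ _)
  obtain ⟨n, hn⟩ : ∃ n : ℕ, P.v u ^ n * C ≤ 1 := by
    rcases eq_or_ne C 0 with rfl | hC0
    · exact ⟨0, by simp⟩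
    refine ⟨C.log.toNat, ?_⟩
    rw [← WithZero.exp_log hC0, hu, ← WithZero.exp_nsmul, ← WithZero.exp_add,
      ← WithZero.exp_zero, WithZero.exp_le_exp, WithZero.exp_log hC0]
    simp
  simpa [hn] using step n f hf

/-- The residue of the logarithmic derivative of `f` at `P` is the order of `f` at `P`. -/
theorem IsUniformizer.v_logDeriv_sub_lt_one (hF : IsFunctionFieldOfCurve k F) {u : F}
    (hu : P.IsUniformizer u) {δ : Derivation k F F} (hδ : P.v (δ u) ≤ 1) {f : F} {n : ℤ}
    (hf : P.v f = WithZero.exp (-n)) : P.v (u * δ f / f - n * δ u) < 1 := by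
  have hu0 := hu.ne_zero
  set g := f / u ^ n with hg
  have hfg : f = u ^ n * g := by
    rw [hg, mul_div_cancel₀ _ (zpow_ne_zero n hu0)]
  have hg1 : P.v g = 1 := by
    rw [hg, map_div₀, map_zpow₀, hf, hu, ← WithZero.exp_zsmul]
    simp
  have hg0 : g ≠ 0 := by rintro h; simp [h] at hg1
  -- With `f = u ^ n * g` and `g` a unit, the term `n * δ u` cancels and only the logarithmic
  -- derivative of `g`, which is regular, survives.
  have key : u * δ f / f - n * δ u = u * (δ g / g) := by
    rw [hfg, Derivation.leibniz, Derivation.leibniz_zpow, zpow_sub_one₀ hu0]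
    have := zpow_ne_zero n hu0
    simp only [smul_eq_mul, zsmul_eq_mul]
    field_simp
    ring
  rw [key, map_mul, map_div₀, hg1, div_one]
  exact mul_lt_one_of_nonneg_of_lt_one_left zero_le hu.v_lt_one (hu.v_derivation_le_one hF hδ hg1.le)

/-- A derivation which is a unit on a local parameter at `P` lowers nonzero orders at `P`
by one. -/
theorem IsUniformizer.v_derivation_eq (hF : IsFunctionFieldOfCurve k F) {u : F}
    (hu : P.IsUniformizer u) {δ : Derivation k F F} (hδ : P.v (δ u) = 1) {f : F} {n : ℤ}
    (hn : n ≠ 0) (hf : P.v f = WithZero.exp (-n)) : P.v (δ f) = WithZero.exp (-(n - 1)) := by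
  have h := hu.v_logDeriv_sub_lt_one hF hδ.le hf
  have h1 : P.v (n * δ u) = 1 := by rw [map_mul, P.v_intCast hn, hδ, one_mul]
  have h2 : P.v (u * δ f / f) = 1 := by
    rw [← h1] at h ⊢
    exact P.v.map_eq_of_sub_lt h
  rw [map_div₀, map_mul, hf, hu, div_eq_one_iff_eq WithZero.exp_ne_zero] at h2
  have h3 : WithZero.exp (1 : ℤ) * (WithZero.exp (-1 : ℤ) * P.v (δ f)) =
    WithZero.exp 1 * WithZero.exp (-n) := by rw [h2]
  rw [← mul_assoc, ← WithZero.exp_add, ← WithZero.exp_add] at h3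
  rw [show (1 : ℤ) + -1 = 0 by norm_num, WithZero.exp_zero, one_mul] at h3
  rw [h3, neg_sub, sub_eq_add_neg]

end CurvePoint

/-! ### The derivation attached to a differential; divisors and orders -/

section

variable {k F : Type*} [Field k] [Field F] [Algebra k F]

namespace IsFunctionFieldOfCurve

variable [CharZero k]

theorem span_singleton_eq_top (hF : IsFunctionFieldOfCurve k F) {ω : Ω[F⁄k]} (hω : ω ≠ 0) :
    Submodule.span F {ω} = ⊤ := by
  obtain ⟨x, hx, -⟩ := id hF
  have hspan := hF.span_D_eq_top hx
  obtain ⟨c, rfl⟩ := Submodule.mem_span_singleton.mp (hspan ▸ Submodule.mem_top (x := ω))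
  have hc : c ≠ 0 := by rintro rfl; simp at hω
  rw [Submodule.span_singleton_smul_eq hc.isUnit, hspan]

/-- The derivation `f ↦ df / ω` attached to a nonzero rational differential `ω`. -/
theorem exists_derivation (hF : IsFunctionFieldOfCurve k F) {ω : Ω[F⁄k]} (hω : ω ≠ 0) :
    ∃ δ : Derivation k F F, ∀ f : F, KaehlerDifferential.D k F f = δ f • ω := by
  obtain ⟨g, hg⟩ := LinearMap.exists_leftInverse_of_injective (LinearMap.toSpanSingleton F _ ω)
    (LinearMap.ker_toSpanSingleton F hω)
  refine ⟨g.compDer (KaehlerDifferential.D k F), fun f ↦ ?_⟩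
  obtain ⟨a, ha⟩ := Submodule.mem_span_singleton.mp
    (hF.span_singleton_eq_top hω ▸ Submodule.mem_top (x := KaehlerDifferential.D k F f))
  have : g (a • ω) = a := LinearMap.congr_fun hg a
  change _ = g (KaehlerDifferential.D k F f) • ω
  rw [← ha, this]

/-- Two functions with the same divisor are proportional. -/
theorem exists_smul_eq [IsAlgClosed k] (hF : IsFunctionFieldOfCurve k F) {f g : F}
    (hg : g ≠ 0) (P₀ : CurvePoint k F) (h : ∀ P : CurvePoint k F, P.v f = P.v g) :
    ∃ c : k, c ≠ 0 ∧ f = algebraMap k F c * g := by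
  have hv : ∀ P : CurvePoint k F, P.v (f / g) = 1 := fun P ↦ by
    rw [map_div₀, h, div_self (P.v.ne_zero_iff.mpr hg)]
  obtain ⟨c, hc⟩ := hF.exists_algebraMap_eq fun P ↦ (hv P).le
  refine ⟨c, ?_, by rw [hc, div_mul_cancel₀ _ hg]⟩
  rintro rfl
  have := hv P₀
  simp [← hc] at this

end IsFunctionFieldOfCurve

theorem HasDivisor.v_eq {f : F} {D : CurveDivisor k F} (h : HasDivisor f D)
    (P : CurvePoint k F) : P.v f = WithZero.exp (-(D P)) := by
  rw [← h.2 P, CurvePoint.ord, neg_neg, WithZero.exp_log (P.v.ne_zero_iff.mpr h.1)]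

open Classical in
theorem sumOfPoints_apply (S : Finset (CurvePoint k F)) (P : CurvePoint k F) :
    sumOfPoints S P = if P ∈ S then 1 else 0 := by
  simp [sumOfPoints, Finsupp.finsetSum_apply, Finsupp.single_apply]

theorem sumOfPoints_mem (S : Finset (CurvePoint k F)) (P : CurvePoint k F) :
    sumOfPoints S P = 0 ∨ sumOfPoints S P = 1 := by
  classical
  rw [sumOfPoints_apply]
  split_ifs <;> simp

namespace CurvePoint

variable {P : CurvePoint k F}

theorem v_eq_exp_neg_ord {f : F} (hf : f ≠ 0) : P.v f = WithZero.exp (-P.ord f) := by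
  rw [ord, neg_neg, WithZero.exp_log (P.v.ne_zero_iff.mpr hf)]

theorem ord_zero : P.ord 0 = 0 := by simp [ord]

theorem ord_pos_iff {f : F} : 0 < P.ord f ↔ f ≠ 0 ∧ P.v f < 1 := by
  rcases eq_or_ne f 0 with rfl | hf
  · simp [ord_zero]
  · rw [v_eq_exp_neg_ord hf, ← WithZero.exp_zero, WithZero.exp_lt_exp]
    simp [hf]

theorem ord_neg_iff {f : F} : P.ord f < 0 ↔ 1 < P.v f := by
  rcases eq_or_ne f 0 with rfl | hf
  · simp [ord_zero]
  · rw [v_eq_exp_neg_ord hf, ← WithZero.exp_zero, WithZero.exp_lt_exp]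
    simp

theorem poleMultiplicity_sub_one (t : F) : poleMultiplicity (t - 1) P = poleMultiplicity t P := by
  rcases le_or_gt (P.v t) 1 with h | h
  · have h1 : P.v (t - 1) ≤ 1 := P.v.map_sub_le h (by simp)
    rw [poleMultiplicity, poleMultiplicity, max_eq_right, max_eq_right]
    · have := mt ord_neg_iff.mp h.not_gt; omega
    · have := mt ord_neg_iff.mp h1.not_gt; omega
  · rw [poleMultiplicity, poleMultiplicity, ord, ord, P.v.map_sub_eq_of_lt_left (by simpa using h)]

end CurvePoint

/-! ### Orders of t and of its translates -/

namespace IsBelyiFunction237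

variable {t : F} {P₀ : CurvePoint k F} {S₁₄ S₉ S₄ : Finset (CurvePoint k F)}

theorem ord_eq (ht : IsBelyiFunction237 t P₀ S₁₄ S₉ S₄) (P : CurvePoint k F) :
    P.ord t = 2 * sumOfPoints S₁₄ P - 7 * sumOfPoints S₄ P := by
  have h0 := ht.fiber_zero P
  have h1 := ht.fiber_infty P
  simp only [fiberMultiplicity, poleMultiplicity, map_zero, sub_zero, Finsupp.smul_apply,
    nsmul_eq_mul, Nat.cast_ofNat] at h0 h1
  omega

theorem ord_sub_one_eq (ht : IsBelyiFunction237 t P₀ S₁₄ S₉ S₄) (P : CurvePoint k F) :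
    P.ord (t - 1) = 3 * sumOfPoints S₉ P + (Finsupp.single P₀ 1 : CurveDivisor k F) P
      - 7 * sumOfPoints S₄ P := by
  have h0 := ht.fiber_one P
  have h1 := ht.fiber_infty P
  rw [← CurvePoint.poleMultiplicity_sub_one] at h1
  simp only [fiberMultiplicity, poleMultiplicity, map_one, Finsupp.smul_apply, Finsupp.add_apply,
    nsmul_eq_mul, Nat.cast_ofNat] at h0 h1
  omega

/-- A point of `S₄` is a pole of `t`, and constants have none. This keeps `t - c` away from the junk
value of `ord` at zero. -/
theorem ne_algebraMap (ht : IsBelyiFunction237 t P₀ S₁₄ S₉ S₄) (c : k) :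
    t ≠ algebraMap k F c := by
  obtain ⟨P, hP⟩ : S₄.Nonempty := Finset.card_pos.mp (by rw [ht.card_four]; norm_num)
  have h := ht.fiber_infty P
  rintro rfl
  have h1 : ¬ P.ord (algebraMap k F c) < 0 :=
    fun h ↦ (P.v_algebraMap_le_one c).not_gt (CurvePoint.ord_neg_iff.mp h)
  simp only [poleMultiplicity, Finsupp.smul_apply, sumOfPoints_apply, if_pos hP, nsmul_eq_mul,
    Nat.cast_ofNat] at h
  omega

/-- The fibres over `0`, `1` and `∞` are disjoint. -/
theorem disjoint (ht : IsBelyiFunction237 t P₀ S₁₄ S₉ S₄) (P : CurvePoint k F) :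
    (sumOfPoints S₁₄ P = 0 ∨ sumOfPoints S₄ P = 0) ∧
      (sumOfPoints S₁₄ P = 0 ∨
        3 * sumOfPoints S₉ P + (Finsupp.single P₀ 1 : CurveDivisor k F) P = 0) ∧
      (sumOfPoints S₄ P = 0 ∨
        3 * sumOfPoints S₉ P + (Finsupp.single P₀ 1 : CurveDivisor k F) P = 0) := by
  have h0 := ht.ord_eq P
  have h1 := ht.ord_sub_one_eq P
  have f0 := ht.fiber_zero P
  have f1 := ht.fiber_one P
  simp only [fiberMultiplicity, map_one, map_zero, sub_zero, Finsupp.smul_apply,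
    Finsupp.add_apply, nsmul_eq_mul, Nat.cast_ofNat] at f0 f1
  have ha := sumOfPoints_mem S₁₄ P
  have hb := sumOfPoints_mem S₉ P
  have hd := sumOfPoints_mem S₄ P
  have h : ¬ (0 < P.ord t ∧ 0 < P.ord (t - 1)) := by
    rw [CurvePoint.ord_pos_iff, CurvePoint.ord_pos_iff]
    rintro ⟨⟨-, h0⟩, -, h1⟩
    simpa using P.v.map_sub_lt h0 h1
  omega

/-- At every point some translate of `t` has a nonzero order that is one more than the order of
`F₁₄ F₉² / F₄⁸`. -/
theorem exists_ord_sub_eq [CharZero k] [IsAlgClosed k] (hF : IsFunctionFieldOfCurve k F)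
    (ht : IsBelyiFunction237 t P₀ S₁₄ S₉ S₄) (P : CurvePoint k F) :
    ∃ (c : k) (n : ℤ), n ≠ 0 ∧ P.ord (t - algebraMap k F c) = n ∧
      n - 1 = sumOfPoints S₁₄ P + 2 * sumOfPoints S₉ P - 8 * sumOfPoints S₄ P := by
  have h0 := ht.ord_eq P
  have h1 := ht.ord_sub_one_eq P
  have f0 := ht.fiber_zero P
  have f1 := ht.fiber_one P
  have f2 := ht.unramified
  simp only [fiberMultiplicity, map_one, map_zero, sub_zero, Finsupp.smul_apply,
    Finsupp.add_apply, nsmul_eq_mul, Nat.cast_ofNat] at f0 f1 f2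
  have ha := sumOfPoints_mem S₁₄ P
  have hb := sumOfPoints_mem S₉ P
  have hd := sumOfPoints_mem S₄ P
  have he : (Finsupp.single P₀ 1 : CurveDivisor k F) P = 0 ∨
      ((Finsupp.single P₀ 1 : CurveDivisor k F) P = 1 ∧ sumOfPoints S₉ P = 0) := by
    classical
    rw [Finsupp.single_apply]
    split_ifs with h
    · exact Or.inr ⟨rfl, by rw [← h, sumOfPoints_apply, if_neg ht.base_notMem]⟩
    · exact Or.inl rfl
  rcases lt_or_ge (P.ord t) 0 with hneg | hnn
  -- At a pole `t` itself serves: its order is `-7`, and `-7 - 1 = -8`.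
  · refine ⟨0, -7, by norm_num, ?_, ?_⟩
    · rw [map_zero, sub_zero]; omega
    · omega
  · have hreg : P.v t ≤ 1 := not_lt.mp fun h ↦ (CurvePoint.ord_neg_iff.mpr h).not_ge hnn
    obtain ⟨c, hc⟩ := P.exists_v_sub_algebraMap_lt_one hF hreg
    have hpos : 0 < P.ord (t - algebraMap k F c) :=
      CurvePoint.ord_pos_iff.mpr ⟨sub_ne_zero.mpr (ht.ne_algebraMap c), hc⟩
    -- A function takes only one value at `P`, so `P` lies in the fibre over `c` and in no other.
    have huniq : ∀ c', 0 < P.ord (t - algebraMap k F c') → c' = c := by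
      intro c' hc'
      by_contra hne
      have h := P.v.map_sub_lt hc (CurvePoint.ord_pos_iff.mp hc').2
      rw [sub_sub_sub_cancel_left, ← map_sub, P.trivial_on_base _ (sub_ne_zero.mpr hne)] at h
      exact h.false
    have hz := huniq 0
    have ho := huniq 1
    rw [map_zero, sub_zero] at hz
    rw [map_one] at ho
    refine ⟨c, P.ord (t - algebraMap k F c), hpos.ne', rfl, ?_⟩
    rcases eq_or_ne c 0 with rfl | hc0
    · have : ¬ 0 < P.ord (t - 1) := fun h ↦ one_ne_zero (ho h)
      rw [map_zero, sub_zero] at hpos ⊢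
      omega
    · have hz' : ¬ 0 < P.ord t := fun h ↦ hc0 (hz h).symm
      rcases eq_or_ne c 1 with rfl | hc1
      · rw [map_one] at hpos ⊢
        omega
      · have : ¬ 0 < P.ord (t - 1) := fun h ↦ hc1 (ho h).symm
        have := f2 c hc0 hc1 P
        omega

end IsBelyiFunction237
end

/-! ### Local leading terms and the differential relations -/

section

variable {k F : Type*} [Field k] [Field F] [Algebra k F]

namespace CurvePoint

variable {P : CurvePoint k F}

theorem v_mul_sub_mul_lt_one {x y a b : F} (hb : P.v b ≤ 1) (ha : P.v a ≤ 1)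
    (hx : P.v (x - a) < 1) (hy : P.v (y - b) < 1) : P.v (x * y - a * b) < 1 := by
  rw [show x * y - a * b = (x - a) * (y - b) + a * (y - b) + (x - a) * b by ring]
  refine P.v.map_add_lt (P.v.map_add_lt ?_ ?_) ?_ <;> rw [map_mul]
  · exact mul_lt_one_of_nonneg_of_lt_one_right hx.le zero_le hy
  · exact mul_lt_one_of_nonneg_of_lt_one_right ha zero_le hy
  · exact mul_lt_one_of_nonneg_of_lt_one_left zero_le hx hb

theorem v_intCast_le_one (n : ℤ) : P.v (n : F) ≤ 1 := by
  simpa using P.v_algebraMap_le_one (n : k)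

/-- The leading term of `α g f'' - β g' f'` at a point where `f` and `g` have nonzero orders
`m` and `n`. -/
theorem IsUniformizer.v_second_order_eq [CharZero k] [IsAlgClosed k]
    (hF : IsFunctionFieldOfCurve k F) {u : F}
    (hu : P.IsUniformizer u) {δ : Derivation k F F} (hδ : P.v (δ u) = 1) {f g : F} {m n : ℤ}
    (hm : m ≠ 0) (hf : P.v f = WithZero.exp (-m)) (hg : P.v g = WithZero.exp (-n))
    {α β : ℤ} (h : α * m * (m - 1) - β * m * n ≠ 0) :
    P.v ((α * g * δ (δ f) - β * δ g * δ f) / f) = WithZero.exp (2 - n) := by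
  have hf0 : f ≠ 0 := P.v.ne_zero_iff.mp (hf ▸ WithZero.exp_ne_zero)
  have hg0 : g ≠ 0 := P.v.ne_zero_iff.mp (hg ▸ WithZero.exp_ne_zero)
  have hδf := hu.v_derivation_eq hF hδ hm hf
  have hδf0 : δ f ≠ 0 := P.v.ne_zero_iff.mp (hδf ▸ WithZero.exp_ne_zero)
  have hle : ∀ l : ℤ, P.v (l * δ u) ≤ 1 := fun l ↦ by
    rw [map_mul, hδ, mul_one]; exact v_intCast_le_one l
  have h1 := hu.v_logDeriv_sub_lt_one hF hδ.le hf
  have h2 := hu.v_logDeriv_sub_lt_one hF hδ.le hδf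
  have h3 := hu.v_logDeriv_sub_lt_one hF hδ.le hg
  have h12 := v_mul_sub_mul_lt_one (hle _) (hle _) h1 h2
  have h13 := v_mul_sub_mul_lt_one (hle _) (hle _) h1 h3
  -- Modulo the maximal ideal at `P`, `u f'/f`, `u f''/f'` and `u g'/g` are `m`, `m - 1` and `n`
  -- times `δ u`. Hence the normalized expression `A` has the residue of `B`.
  set B := ((α * m * (m - 1) - β * m * n : ℤ) : F) * δ u ^ 2 with hB
  set A := u ^ 2 * (α * g * δ (δ f) - β * δ g * δ f) / (f * g) with hA
  have hAB : P.v (A - B) < 1 := by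
    have : A - B = α * (u * δ f / f * (u * δ (δ f) / δ f) - m * δ u * ((m - 1 : ℤ) * δ u)) -
        β * (u * δ f / f * (u * δ g / g) - m * δ u * (n * δ u)) := by
      rw [hA, hB]
      push_cast
      field_simp
      ring
    rw [this]
    refine P.v.map_sub_lt ?_ ?_ <;> rw [map_mul]
    · exact mul_lt_one_of_nonneg_of_lt_one_right (v_intCast_le_one α) zero_le h12
    · exact mul_lt_one_of_nonneg_of_lt_one_right (v_intCast_le_one β) zero_le h13
  have hBv : P.v B = 1 := by rw [hB, map_mul, P.v_intCast h, map_pow, hδ, one_pow, one_mul]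
  have hAv : P.v A = 1 := by
    rw [← hBv] at hAB ⊢
    exact P.v.map_eq_of_sub_lt hAB
  have : (α * g * δ (δ f) - β * δ g * δ f) / f = A * g / u ^ 2 := by
    have := hu.ne_zero
    rw [hA]; field_simp
  rw [this, map_div₀, map_mul, hAv, hg, map_pow, hu, one_mul, ← WithZero.exp_nsmul,
    ← WithZero.exp_sub]
  congr 1
  simp; ring

/-- The quotient has two expressions, `A / C = R / B`, and one of them has a unit denominator. -/
theorem isRegularAt_div {A B C R : F} (hC0 : C ≠ 0) (hA : P.v A ≤ 1) (hR : P.v R ≤ 1)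
    (h : B * A = C * R) (hBC : P.v B = 1 ∨ P.v C = 1) : P.IsRegularAt (A / C) := by
  rcases hBC with hB | hC
  · have hB0 : B ≠ 0 := by rintro rfl; simp at hB
    rw [show A / C = R / B by rw [div_eq_div_iff hC0 hB0]; linear_combination h, IsRegularAt,
      map_div₀, hB, div_one]
    exact hR
  · rw [IsRegularAt, map_div₀, hC, div_one]
    exact hA

theorem not_isRegularAt_of_v_eq_exp {f : F} {n : ℤ} (hf : P.v f = WithZero.exp n) (hn : 0 < n) :
    ¬ P.IsRegularAt f := by
  rw [IsRegularAt, hf, ← WithZero.exp_zero, WithZero.exp_le_exp]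
  exact hn.not_ge

end CurvePoint

/-- A holomorphic differential has no poles, so it is at least as divisible as `du` for a local
parameter `u`. -/
theorem IsHolomorphicDifferential.exists_isUniformizer {ω : Ω[F⁄k]}
    (hω : IsHolomorphicDifferential ω) (hω₀ : ω ≠ 0) {δ : Derivation k F F}
    (hδ : ∀ f : F, KaehlerDifferential.D k F f = δ f • ω) (P : CurvePoint k F) :
    ∃ u g : F, P.IsUniformizer u ∧ P.v g ≤ 1 ∧ g * δ u = 1 := by
  obtain ⟨u, g, hu, hg, h⟩ := hω P
  refine ⟨u, g, hu, hg, ?_⟩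
  rw [hδ, smul_smul] at h
  have h' : (1 - g * δ u) • ω = 0 := by rw [sub_smul, one_smul, ← h, sub_self]
  exact (sub_eq_zero.mp ((smul_eq_zero.mp h').resolve_right hω₀)).symm

/-- The first order differential relations among functions that parametrize a curve
`t = a F₁₄² / F₄⁷`, `t - 1 = b F₉³ / F₄⁷`. -/
theorem wronskian_relations (δ : Derivation k F F) {t F₁₄ F₉ F₄ : F} {a b c : k}
    (ha : a ≠ 0) (hb : b ≠ 0) (h₁₄ : F₁₄ ≠ 0) (h₉ : F₉ ≠ 0) (h₄ : F₄ ≠ 0)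
    (ht : t = algebraMap k F a * (F₁₄ ^ 2 / F₄ ^ 7))
    (ht₁ : t - 1 = algebraMap k F b * (F₉ ^ 3 / F₄ ^ 7))
    (hδt : δ t = algebraMap k F c * (F₁₄ * F₉ ^ 2 / F₄ ^ 8)) :
    3 * F₄ * δ F₉ - 7 * δ F₄ * F₉ = algebraMap k F (c / b) * F₁₄ ∧
      2 * F₄ * δ F₁₄ - 7 * δ F₄ * F₁₄ = algebraMap k F (c / a) * F₉ ^ 2 ∧
      2 * F₉ * δ F₁₄ - 3 * δ F₉ * F₁₄ = algebraMap k F (-c / (a * b)) * F₄ ^ 6 := by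
  have ha' : algebraMap k F a ≠ 0 := by simpa using ha
  have hb' : algebraMap k F b ≠ 0 := by simpa using hb
  have hδ : ∀ (x : k) (f : F), δ (algebraMap k F x * f) = algebraMap k F x * δ f := by
    intro x f; simp [Derivation.leibniz]
  have e1 : 3 * F₄ * δ F₉ - 7 * δ F₄ * F₉ = algebraMap k F (c / b) * F₁₄ := by
    have h : δ (t - 1) = δ t := by simp
    rw [hδt, ht₁, hδ, Derivation.leibniz_div, Derivation.leibniz_pow, Derivation.leibniz_pow] at h
    rw [map_div₀]
    simp only [smul_eq_mul, nsmul_eq_mul] at h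
    field_simp at h ⊢
    push_cast at h
    refine mul_left_cancel₀ (mul_ne_zero (pow_ne_zero 6 h₄) (pow_ne_zero 2 h₉)) ?_
    linear_combination h
  have e2 : 2 * F₄ * δ F₁₄ - 7 * δ F₄ * F₁₄ = algebraMap k F (c / a) * F₉ ^ 2 := by
    have h := hδt
    rw [ht, hδ, Derivation.leibniz_div, Derivation.leibniz_pow, Derivation.leibniz_pow] at h
    rw [map_div₀]
    simp only [smul_eq_mul, nsmul_eq_mul] at h
    field_simp at h ⊢
    push_cast at h
    refine mul_left_cancel₀ (mul_ne_zero (pow_ne_zero 6 h₄) h₁₄) ?_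
    linear_combination h
  refine ⟨e1, e2, ?_⟩
  -- This syzygy gives the third relation: `F₉` times the second minus `F₁₄` times the first
  -- eliminates `δ F₄`, and the right side becomes a multiple of `F₄ ^ 7`.
  have h : algebraMap k F a * F₁₄ ^ 2 - algebraMap k F b * F₉ ^ 3 = F₄ ^ 7 := by
    rw [ht] at ht₁
    field_simp at ht₁
    linear_combination ht₁
  rw [map_div₀] at e1 e2 ⊢
  rw [map_neg, map_mul]
  field_simp at e1 e2 ⊢
  refine mul_left_cancel₀ h₄ ?_
  linear_combination F₉ * algebraMap k F b * e2 - F₁₄ * algebraMap k F a * e1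
    - algebraMap k F c * h

/-- The consequences of the first order differential relations that bound the poles of the
second order differential expressions. -/
theorem second_order_relations (δ : Derivation k F F) {F₁₄ F₉ F₄ : F} {a b c : k}
    (h₁ : 3 * F₄ * δ F₉ - 7 * δ F₄ * F₉ = algebraMap k F a * F₁₄)
    (h₂ : 2 * F₄ * δ F₁₄ - 7 * δ F₄ * F₁₄ = algebraMap k F b * F₉ ^ 2)
    (h₃ : 2 * F₉ * δ F₁₄ - 3 * δ F₉ * F₁₄ = algebraMap k F c * F₄ ^ 6) :
    F₉ * (14 * F₉ * δ (δ F₄) - 13 * δ F₉ * δ F₄) = F₄ * (6 * F₉ * δ (δ F₉) - 9 * δ F₉ ^ 2 -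
        algebraMap k F a * algebraMap k F c * F₄ ^ 5) ∧
      F₄ * (6 * F₄ * δ (δ F₉) - 29 * δ F₄ * δ F₉) = F₉ * (algebraMap k F a * algebraMap k F b * F₉ +
        14 * F₄ * δ (δ F₄) - 49 * δ F₄ ^ 2) ∧
      F₄ * (6 * F₄ * δ (δ F₁₄) - 43 * δ F₄ * δ F₁₄) = F₁₄ * (2 * (algebraMap k F a *
        algebraMap k F b) * F₉ + 21 * F₄ * δ (δ F₄) - 98 * δ F₄ ^ 2) := by
  have d₁ : 3 * F₄ * δ (δ F₉) - 4 * δ F₄ * δ F₉ - 7 * δ (δ F₄) * F₉ =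
      algebraMap k F a * δ F₁₄ := by
    have h := congrArg δ h₁
    simp only [map_sub, Derivation.leibniz, smul_eq_mul, Derivation.map_algebraMap] at h
    have h3 : δ 3 = 0 := by exact_mod_cast δ.map_natCast 3
    have h7 : δ 7 = 0 := by exact_mod_cast δ.map_natCast 7
    rw [h3, h7] at h
    linear_combination h
  have d₂ : 2 * F₄ * δ (δ F₁₄) - 5 * δ F₄ * δ F₁₄ - 7 * δ (δ F₄) * F₁₄ =
      algebraMap k F b * (2 * F₉ * δ F₉) := by
    have h := congrArg δ h₂
    simp only [map_sub, Derivation.leibniz, Derivation.leibniz_pow, smul_eq_mul, nsmul_eq_mul,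
      Derivation.map_algebraMap] at h
    have h2 : δ 2 = 0 := by exact_mod_cast δ.map_natCast 2
    have h7 : δ 7 = 0 := by exact_mod_cast δ.map_natCast 7
    rw [h2, h7] at h
    push_cast at h
    linear_combination h
  -- In each case the multiples are chosen so that the right sides reassemble into the left side of
  -- another first order relation. Substituting it makes the remaining terms divisible by `F₄`,
  -- `F₉`, `F₁₄` respectively.
  refine ⟨?_, ?_, ?_⟩
  · linear_combination (-2 * F₉) * d₁ + 3 * δ F₉ * h₁ - algebraMap k F a * h₃
  · linear_combination 2 * F₄ * d₁ - 7 * δ F₄ * h₁ + algebraMap k F a * h₂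
  · linear_combination 3 * F₄ * d₂ + 2 * algebraMap k F b * F₉ * h₁ - 14 * δ F₄ * h₂

variable [CharZero k] [IsAlgClosed k]

/-- On a curve with a Belyi function `t` of the given type, `dt / ω` is proportional to
`F₁₄ F₉² / F₄⁸`, and `ω` has no zeros. -/
theorem IsBelyiFunction237.derivation_eq (hF : IsFunctionFieldOfCurve k F)
    {t : F} {P₀ : CurvePoint k F} {S₁₄ S₉ S₄ : Finset (CurvePoint k F)}
    (ht : IsBelyiFunction237 t P₀ S₁₄ S₉ S₄) {G : F}
    (hG : ∀ P : CurvePoint k F, P.v G =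
      WithZero.exp (-(sumOfPoints S₁₄ P + 2 * sumOfPoints S₉ P - 8 * sumOfPoints S₄ P)))
    {ω : Ω[F⁄k]} (hω₀ : ω ≠ 0) (hω : IsHolomorphicDifferential ω) {δ : Derivation k F F}
    (hδ : ∀ f : F, KaehlerDifferential.D k F f = δ f • ω) :
    (∃ c : k, c ≠ 0 ∧ δ t = algebraMap k F c * G) ∧
      ∀ P : CurvePoint k F, ∃ u : F, P.IsUniformizer u ∧ P.v (δ u) = 1 := by
  have key : ∀ P : CurvePoint k F, ∃ u g : F, P.IsUniformizer u ∧ P.v g ≤ 1 ∧ g * δ u = 1 ∧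
      P.v g * P.v (δ t) = P.v G := by
    intro P
    obtain ⟨u, g, hu, hg, hgu⟩ := hω.exists_isUniformizer hω₀ hδ P
    refine ⟨u, g, hu, hg, hgu, ?_⟩
    obtain ⟨c, n, hn, hord, hn1⟩ := ht.exists_ord_sub_eq hF P
    have hv : P.v (t - algebraMap k F c) = WithZero.exp (-n) := by
      rw [CurvePoint.v_eq_exp_neg_ord (sub_ne_zero.mpr (ht.ne_algebraMap c)), hord]
    -- Since `g * δ u = 1`, the derivation `g • δ` is `d/du`.
    have := hu.v_derivation_eq (δ := g • δ) hF (by simp [hgu]) hn hv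
    rw [hG, ← hn1, ← this, ← map_mul]
    simp
  have hG0 : G ≠ 0 := P₀.v.ne_zero_iff.mp (hG P₀ ▸ WithZero.exp_ne_zero)
  have hδt : δ t ≠ 0 := by
    intro h
    obtain ⟨u, g, -, -, -, h'⟩ := key P₀
    rw [h, map_zero, mul_zero] at h'
    exact hG0 (P₀.v.zero_iff.mp h'.symm)
  have hq : ∀ P : CurvePoint k F, ∃ u g : F, P.IsUniformizer u ∧ P.v g ≤ 1 ∧ g * δ u = 1 ∧
      P.v (G / δ t) = P.v g := by
    intro P
    obtain ⟨u, g, hu, hg, hgu, h⟩ := key P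
    exact ⟨u, g, hu, hg, hgu, by
      rw [map_div₀, ← h, mul_div_cancel_right₀ _ (P.v.ne_zero_iff.mpr hδt)]⟩
  obtain ⟨c, hc⟩ := hF.exists_algebraMap_eq (f := G / δ t) fun P ↦ by
    obtain ⟨u, g, -, hg, -, h⟩ := hq P
    exact h ▸ hg
  have hc0 : c ≠ 0 := by
    rintro rfl
    rw [map_zero] at hc
    exact div_ne_zero hG0 hδt hc.symm
  refine ⟨⟨c⁻¹, inv_ne_zero hc0, ?_⟩, fun P ↦ ?_⟩
  · rw [map_inv₀, hc, inv_div, div_mul_cancel₀ _ hG0]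
  · obtain ⟨u, g, hu, -, hgu, h⟩ := hq P
    refine ⟨u, hu, ?_⟩
    -- Constancy of `G / δ t` makes `g` a unit at every point: `ω` has no zeros.
    rw [← hc, P.trivial_on_base c hc0] at h
    have := congrArg P.v hgu
    rwa [map_mul, ← h, one_mul, map_one] at this

end

/-! ### Assembly of the theorem -/

theorem proposition2 {k F : Type*} [Field k] [IsAlgClosed k] [CharZero k] [Field F] [Algebra k F]
    (hF : IsFunctionFieldOfCurve k F)
    (t : F) (P₀ : CurvePoint k F) (S₁₄ S₉ S₄ : Finset (CurvePoint k F))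
    (ht : IsBelyiFunction237 t P₀ S₁₄ S₉ S₄)
    (F₁₄ F₉ F₄ : F)
    (hF₁₄ : HasDivisor F₁₄ (sumOfPoints S₁₄ - 14 • Finsupp.single P₀ 1))
    (hF₉ : HasDivisor F₉ (sumOfPoints S₉ - 9 • Finsupp.single P₀ 1))
    (hF₄ : HasDivisor F₄ (sumOfPoints S₄ - 4 • Finsupp.single P₀ 1))
    (ω : Ω[F⁄k]) (hω₀ : ω ≠ 0) (hω : IsHolomorphicDifferential ω) :
    ∃ δ : Derivation k F F, (∀ f : F, KaehlerDifferential.D k F f = δ f • ω) ∧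
      ((∃ c : k, c ≠ 0 ∧ F₁₄ = c • (3 * F₄ * δ F₉ - 7 * δ F₄ * F₉)) ∧
        (∃ c : k, c ≠ 0 ∧ F₉ ^ 2 = c • (2 * F₄ * δ F₁₄ - 7 * δ F₄ * F₁₄)) ∧
        (∃ c : k, c ≠ 0 ∧ F₄ ^ 6 = c • (2 * F₉ * δ F₁₄ - 3 * δ F₉ * F₁₄))) ∧
      (∀ P : CurvePoint k F,
        (P.IsRegularAt ((14 * F₉ * δ (δ F₄) - 13 * δ F₉ * δ F₄) / F₄) ↔ P ≠ P₀) ∧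
        (P.IsRegularAt ((6 * F₄ * δ (δ F₉) - 29 * δ F₄ * δ F₉) / F₉) ↔ P ≠ P₀) ∧
        (P.IsRegularAt ((6 * F₄ * δ (δ F₁₄) - 43 * δ F₄ * δ F₁₄) / F₁₄) ↔ P ≠ P₀)) := by
  classical
  have h₁₄ := hF₁₄.1
  have h₉ := hF₉.1
  have h₄ := hF₄.1
  have v₁₄ : ∀ P : CurvePoint k F, P.v F₁₄ = WithZero.exp
      (-(sumOfPoints S₁₄ P - 14 * (Finsupp.single P₀ 1 : CurveDivisor k F) P)) := fun P ↦ by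
    simpa only [Finsupp.sub_apply, Finsupp.smul_apply, nsmul_eq_mul, Nat.cast_ofNat] using
      hF₁₄.v_eq P
  have v₉ : ∀ P : CurvePoint k F, P.v F₉ = WithZero.exp
      (-(sumOfPoints S₉ P - 9 * (Finsupp.single P₀ 1 : CurveDivisor k F) P)) := fun P ↦ by
    simpa only [Finsupp.sub_apply, Finsupp.smul_apply, nsmul_eq_mul, Nat.cast_ofNat] using
      hF₉.v_eq P
  have v₄ : ∀ P : CurvePoint k F, P.v F₄ = WithZero.exp
      (-(sumOfPoints S₄ P - 4 * (Finsupp.single P₀ 1 : CurveDivisor k F) P)) := fun P ↦ by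
    simpa only [Finsupp.sub_apply, Finsupp.smul_apply, nsmul_eq_mul, Nat.cast_ofNat] using
      hF₄.v_eq P
  have ht0 : t ≠ 0 := by simpa using ht.ne_algebraMap 0
  have ht1 : t - 1 ≠ 0 := sub_ne_zero.mpr (by simpa using ht.ne_algebraMap 1)
  -- At `P₀` the orders balance: `2 * 14 = 7 * 4` here, `7 * 4 - 3 * 9 = 1` for `t - 1`, and `8 * 4
  -- - 14 - 2 * 9 = 0` for `G`.
  obtain ⟨a, ha, hta⟩ := hF.exists_smul_eq (f := t) (g := F₁₄ ^ 2 / F₄ ^ 7)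
    (by positivity) P₀ fun P ↦ by
      rw [CurvePoint.v_eq_exp_neg_ord ht0, ht.ord_eq, map_div₀, map_pow, map_pow, v₁₄, v₄,
        ← WithZero.exp_nsmul, ← WithZero.exp_nsmul, ← WithZero.exp_sub]
      congr 1; simp only [nsmul_eq_mul]; push_cast; ring
  obtain ⟨b, hb, htb⟩ := hF.exists_smul_eq (f := t - 1) (g := F₉ ^ 3 / F₄ ^ 7)
    (by positivity) P₀ fun P ↦ by
      rw [CurvePoint.v_eq_exp_neg_ord ht1, ht.ord_sub_one_eq, map_div₀, map_pow, map_pow, v₉, v₄,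
        ← WithZero.exp_nsmul, ← WithZero.exp_nsmul, ← WithZero.exp_sub]
      congr 1; simp only [nsmul_eq_mul]; push_cast; ring
  obtain ⟨δ, hδ⟩ := hF.exists_derivation hω₀
  obtain ⟨⟨c, hc, htc⟩, hunif⟩ := ht.derivation_eq hF (G := F₁₄ * F₉ ^ 2 / F₄ ^ 8) (fun P ↦ by
      rw [map_div₀, map_mul, map_pow, map_pow, v₁₄, v₉, v₄, ← WithZero.exp_nsmul,
        ← WithZero.exp_nsmul, ← WithZero.exp_add, ← WithZero.exp_sub]
      congr 1; simp only [nsmul_eq_mul]; push_cast; ring) hω₀ hω hδ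
  obtain ⟨e1, e2, e3⟩ := wronskian_relations δ ha hb h₁₄ h₉ h₄ hta htb htc
  have hscal : ∀ {c : k} {f g : F}, c ≠ 0 → g = algebraMap k F c * f →
      ∃ c : k, c ≠ 0 ∧ f = c • g := fun {c f g} hc h ↦ by
    refine ⟨c⁻¹, inv_ne_zero hc, ?_⟩
    rw [h, ← Algebra.smul_def, smul_smul, inv_mul_cancel₀ hc, one_smul]
  refine ⟨δ, hδ, ⟨hscal (div_ne_zero hc hb) e1, hscal (div_ne_zero hc ha) e2,
    hscal (div_ne_zero (neg_ne_zero.mpr hc) (mul_ne_zero ha hb)) e3⟩, fun P ↦ ?_⟩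
  obtain ⟨u, hu, hδu⟩ := hunif P
  obtain ⟨d1, d2, d3⟩ := ht.disjoint P
  have ha := sumOfPoints_mem S₁₄ P
  have hb := sumOfPoints_mem S₉ P
  have hd := sumOfPoints_mem S₄ P
  have v₁₄ := v₁₄ P
  have v₉ := v₉ P
  have v₄ := v₄ P
  rcases eq_or_ne P P₀ with hP | hP
  · simp only [hP, ne_eq, not_true_eq_false, iff_false]
    rw [← hP, Finsupp.single_eq_same] at v₁₄ v₉ v₄ d2 d3
    obtain ⟨ha0, hb0, hd0⟩ : sumOfPoints S₁₄ P = 0 ∧ sumOfPoints S₉ P = 0 ∧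
        sumOfPoints S₄ P = 0 := by
      have : sumOfPoints S₉ P = 0 := by
        rw [sumOfPoints_apply, if_neg (hP ▸ ht.base_notMem)]
      omega
    rw [ha0] at v₁₄
    rw [hb0] at v₉
    rw [hd0] at v₄
    rw [← hP]
    refine ⟨?_, ?_, ?_⟩
    -- The orders of `F₁₄`, `F₉`, `F₄` here are `-14`, `-9`, `-4`. The three leading coefficients
    -- are `-188`, `-504`, `-1148`, giving poles of order 11, 6, 6.
    · have := hu.v_second_order_eq hF hδu (α := 14) (β := 13) (by norm_num) v₄ v₉ (by norm_num)
      exact CurvePoint.not_isRegularAt_of_v_eq_exp (n := 11) (by simpa using this)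
        (by norm_num)
    · have := hu.v_second_order_eq hF hδu (α := 6) (β := 29) (by norm_num) v₉ v₄ (by norm_num)
      exact CurvePoint.not_isRegularAt_of_v_eq_exp (n := 6) (by simpa using this)
        (by norm_num)
    · have := hu.v_second_order_eq hF hδu (α := 6) (β := 43) (by norm_num) v₁₄ v₄ (by norm_num)
      exact CurvePoint.not_isRegularAt_of_v_eq_exp (n := 6) (by simpa using this)
        (by norm_num)
  · simp only [ne_eq, hP, not_false_eq_true, iff_true]
    rw [Finsupp.single_eq_of_ne hP, mul_zero, sub_zero] at v₁₄ v₉ v₄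
    rw [Finsupp.single_eq_of_ne hP] at d2 d3
    have hexp : ∀ n : ℤ, n = 0 ∨ n = 1 → WithZero.exp (-n) ≤ (1 : ℤᵐ⁰) := fun n hn ↦ by
      rw [← WithZero.exp_zero, WithZero.exp_le_exp]; omega
    -- Away from `P₀` the local ring contains `F₁₄`, `F₉`, `F₄` and is stable under `δ`, so all
    -- numerators and cofactors are regular.
    let O := P.v.integer
    have hδO : ∀ f ∈ O, δ f ∈ O := fun f hf ↦ hu.v_derivation_le_one hF hδu.le hf
    have cO : ∀ x : k, algebraMap k F x ∈ O := P.v_algebraMap_le_one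
    have m₁₄ : F₁₄ ∈ O := v₁₄.trans_le (hexp _ ha)
    have m₉ : F₉ ∈ O := v₉.trans_le (hexp _ hb)
    have m₄ : F₄ ∈ O := v₄.trans_le (hexp _ hd)
    have hunit : ∀ {f : F} {n : ℤ}, P.v f = WithZero.exp (-n) → n = 0 → P.v f = 1 := by
      rintro f n h rfl; simpa using h
    have lO : ∀ (n : ℕ) [n.AtLeastTwo], (OfNat.ofNat n : F) ∈ O := fun n ↦ ofNat_mem O n
    have dd₁₄ := hδO _ (hδO _ m₁₄)
    have dd₉ := hδO _ (hδO _ m₉)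
    have dd₄ := hδO _ (hδO _ m₄)
    obtain ⟨q₁, q₂, q₃⟩ := second_order_relations δ e1 e2 e3
    refine ⟨CurvePoint.isRegularAt_div h₄ ?_ ?_ q₁ ?_,
      CurvePoint.isRegularAt_div h₉ ?_ ?_ q₂ ?_, CurvePoint.isRegularAt_div h₁₄ ?_ ?_ q₃ ?_⟩
    · exact sub_mem (mul_mem (mul_mem (lO 14) m₉) dd₄)
        (mul_mem (mul_mem (lO 13) (hδO _ m₉)) (hδO _ m₄))
    · exact sub_mem (sub_mem (mul_mem (mul_mem (lO 6) m₉) dd₉)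
        (mul_mem (lO 9) (pow_mem (hδO _ m₉) 2))) (mul_mem (mul_mem (cO _) (cO _)) (pow_mem m₄ 5))
    · have : sumOfPoints S₉ P = 0 ∨ sumOfPoints S₄ P = 0 := by omega
      exact this.imp (hunit v₉) (hunit v₄)
    · exact sub_mem (mul_mem (mul_mem (lO 6) m₄) dd₉)
        (mul_mem (mul_mem (lO 29) (hδO _ m₄)) (hδO _ m₉))
    · exact sub_mem (add_mem (mul_mem (mul_mem (cO _) (cO _)) m₉)
        (mul_mem (mul_mem (lO 14) m₄) dd₄)) (mul_mem (lO 49) (pow_mem (hδO _ m₄) 2))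
    · have : sumOfPoints S₄ P = 0 ∨ sumOfPoints S₉ P = 0 := by omega
      exact this.imp (hunit v₄) (hunit v₉)
    · exact sub_mem (mul_mem (mul_mem (lO 6) m₄) dd₁₄)
        (mul_mem (mul_mem (lO 43) (hδO _ m₄)) (hδO _ m₁₄))
    · exact sub_mem (add_mem (mul_mem (mul_mem (lO 2) (mul_mem (cO _) (cO _))) m₉)
        (mul_mem (mul_mem (lO 21) m₄) dd₄)) (mul_mem (lO 98) (pow_mem (hδO _ m₄) 2))
    · exact d1.symm.imp (hunit v₄) (hunit v₁₄)
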